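/- Let $k$ be an algebraically closed field of characteristic zero and let $(A,\mathfrak m)$ be an Artinian local $k$-algebra with residue field $k$. Suppose that $A$ is level of socle degree $3$ and type $\tau$, that is, $\mathfrak m^3\neq 0$, $\mathfrak m^4=0$, $\operatorname{Soc}(A):=(0:_A\mathfrak m)=\mathfrak m^3$ and $\dim_k \operatorname{Soc}(A)=\tau$. Suppose also that $A$ is compressed, that is, its $h$-vector $\bigl(\dim_k \mathfrak m^j/\mathfrak m^{j+1}\bigr)_{0\le j\le 3}$ equals $$\Bigl(1,\ m,\ \min\bigl\{\tau m,\tbinom{m+1}{2}\bigr\},\ \tau\Bigr)$$ for some $m$ (the embedding dimension of $A$). Then $A$ is graded: there is an isomorphism of $k$-algebras $$A\;\cong\; G=\bigoplus_{j\ge 0}\mathfrak m^j/\mathfrak m^{j+1}$$ between $A$ and its associated graded ring. -/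

import Mathlib

open scoped DirectSum

section AssociatedGraded

variable {A : Type*} [CommRing A]

/-- The degree `n` piece `I ^ n / I ^ (n + 1)` of the associated graded ring of the ideal `I`. -/
def GrPiece (I : Ideal A) (n : ℕ) : Type _ :=
  ↥(I ^ n) ⧸ Submodule.comap (I ^ n).subtype (I ^ (n + 1))

namespace GrPiece

instance (I : Ideal A) (n : ℕ) : AddCommGroup (GrPiece I n) :=
  inferInstanceAs (AddCommGroup (↥(I ^ n) ⧸ Submodule.comap (I ^ n).subtype (I ^ (n + 1))))

/-- Scalars act through `A`; this includes both `k = A` and the ground field of a `k`-algebra. -/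
instance (k : Type*) [CommRing k] [Algebra k A] (I : Ideal A) (n : ℕ) : Module k (GrPiece I n) :=
  inferInstanceAs (Module k (↥(I ^ n) ⧸ Submodule.comap (I ^ n).subtype (I ^ (n + 1))))

/-- The class of `x ∈ I ^ n` in `I ^ n / I ^ (n + 1)`. -/
def mk (I : Ideal A) (n : ℕ) : ↥(I ^ n) →ₗ[A] GrPiece I n :=
  Submodule.mkQ (Submodule.comap (I ^ n).subtype (I ^ (n + 1)))

theorem mk_surjective (I : Ideal A) (n : ℕ) : Function.Surjective (mk I n) :=
  Submodule.mkQ_surjective _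

theorem mk_eq_zero (I : Ideal A) (n : ℕ) (x : ↥(I ^ n)) :
    mk I n x = 0 ↔ (x : A) ∈ I ^ (n + 1) := by
  change Submodule.Quotient.mk x = 0 ↔ _
  rw [Submodule.Quotient.mk_eq_zero]
  rfl

theorem smul_mk (k : Type*) [CommRing k] [Algebra k A] (I : Ideal A) (n : ℕ) (c : k)
    (x : ↥(I ^ n)) : c • mk I n x = mk I n (c • x) := rfl

/-- The product of elements of `I ^ i` and `I ^ j`, as an element of `I ^ (i + j)`. -/
def mulAux (I : Ideal A) (i j : ℕ) : ↥(I ^ i) →ₗ[A] ↥(I ^ j) →ₗ[A] ↥(I ^ (i + j)) :=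
  LinearMap.mk₂ A
    (fun x y => ⟨(x : A) * (y : A), by
      rw [pow_add]
      exact Ideal.mul_mem_mul x.2 y.2⟩)
    (fun x x' y => Subtype.ext (add_mul (x : A) x' y))
    (fun c x y => Subtype.ext (mul_assoc c (x : A) y))
    (fun x y y' => Subtype.ext (mul_add (x : A) y y'))
    (fun c x y => Subtype.ext (mul_left_comm (x : A) c y))

/-- The multiplication `I ^ i / I ^ (i + 1) × I ^ j / I ^ (j + 1) → I ^ (i + j) / I ^ (i + j + 1)`
induced by the multiplication of `A`. -/
def mul (I : Ideal A) (i j : ℕ) : GrPiece I i →ₗ[A] GrPiece I j →ₗ[A] GrPiece I (i + j) :=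
  Submodule.liftQ _
    (LinearMap.flip
      (Submodule.liftQ _ (LinearMap.flip ((mulAux I i j).compr₂ (mk I (i + j)))) (by
        intro y hy
        rw [LinearMap.mem_ker]
        ext x
        refine (mk_eq_zero I _ _).2 ?_
        rw [add_assoc, pow_add]
        exact Ideal.mul_mem_mul x.2 hy)))
    (by
      intro x hx
      rw [LinearMap.mem_ker]
      ext y
      obtain ⟨y, rfl⟩ := mk_surjective I j y
      refine (mk_eq_zero I _ _).2 ?_
      rw [add_right_comm, pow_add]
      exact Ideal.mul_mem_mul hx y.2)

theorem mul_mk (I : Ideal A) (i j : ℕ) (x : ↥(I ^ i)) (y : ↥(I ^ j)) :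
    mul I i j (mk I i x) (mk I j y) = mk I (i + j) (mulAux I i j x y) := rfl

/-- The class of an element of `A` in `A / I`, the degree zero piece. -/
def zeroMk (I : Ideal A) : A →ₗ[A] GrPiece I 0 :=
  (mk I 0).comp (LinearMap.codRestrict (I ^ 0) LinearMap.id (by simp))

theorem sigma_ext (I : Ideal A) {i j : ℕ} (h : i = j) (x : ↥(I ^ i)) (y : ↥(I ^ j))
    (hxy : (x : A) = y) :
    GradedMonoid.mk (A := GrPiece I) i (mk I i x) = GradedMonoid.mk j (mk I j y) := by
  subst h
  rw [Subtype.ext hxy]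

instance gOne (I : Ideal A) : GradedMonoid.GOne (GrPiece I) := ⟨zeroMk I 1⟩

instance gMul (I : Ideal A) : GradedMonoid.GMul (GrPiece I) := ⟨fun {i j} x y => mul I i j x y⟩

instance gCommRing (I : Ideal A) : DirectSum.GCommRing (GrPiece I) where
  mul_zero x := map_zero _
  zero_mul y := LinearMap.map_zero₂ _ _
  mul_add x y z := map_add _ _ _
  add_mul x y z := LinearMap.map_add₂ _ _ _ _
  one_mul := by
    rintro ⟨i, x⟩
    obtain ⟨x, rfl⟩ := mk_surjective I i x
    exact sigma_ext I (zero_add i) _ _ (one_mul (x : A))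
  mul_one := by
    rintro ⟨i, x⟩
    obtain ⟨x, rfl⟩ := mk_surjective I i x
    exact sigma_ext I (add_zero i) _ _ (mul_one (x : A))
  mul_assoc := by
    rintro ⟨i, x⟩ ⟨j, y⟩ ⟨l, z⟩
    obtain ⟨x, rfl⟩ := mk_surjective I i x
    obtain ⟨y, rfl⟩ := mk_surjective I j y
    obtain ⟨z, rfl⟩ := mk_surjective I l z
    exact sigma_ext I (add_assoc i j l) _ _ (mul_assoc (x : A) y z)
  mul_comm := by
    rintro ⟨i, x⟩ ⟨j, y⟩
    obtain ⟨x, rfl⟩ := mk_surjective I i x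
    obtain ⟨y, rfl⟩ := mk_surjective I j y
    exact sigma_ext I (add_comm i j) _ _ (mul_comm (x : A) y)
  natCast n := zeroMk I n
  natCast_zero := by rw [Nat.cast_zero, map_zero]
  natCast_succ n := by rw [Nat.cast_succ, map_add]; rfl
  intCast n := zeroMk I n
  intCast_ofNat n := by rw [Int.cast_natCast]
  intCast_negSucc_ofNat n := by rw [Int.cast_negSucc, map_neg]

instance gAlgebra (k : Type*) [CommRing k] [Algebra k A] (I : Ideal A) :
    DirectSum.GAlgebra k (GrPiece I) where
  toFun := (zeroMk I).toAddMonoidHom.comp (algebraMap k A).toAddMonoidHom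
  map_one := congrArg (zeroMk I) (map_one (algebraMap k A))
  map_mul r s := sigma_ext I rfl _ _ (map_mul (algebraMap k A) r s)
  commutes := by
    rintro r ⟨i, x⟩
    obtain ⟨x, rfl⟩ := mk_surjective I i x
    exact sigma_ext I (add_comm 0 i) _ _ (mul_comm (algebraMap k A r) (x : A))
  smul_def := by
    rintro r ⟨i, x⟩
    obtain ⟨x, rfl⟩ := mk_surjective I i x
    exact sigma_ext I (zero_add i).symm _ _ (Algebra.smul_def r (x : A))

end GrPiece

/-- The associated graded ring `G = ⨁ₙ Iⁿ / Iⁿ⁺¹` of the ideal `I`; it is a commutative ring, and a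
`k`-algebra whenever `A` is one. -/
abbrev AssocGraded (I : Ideal A) : Type _ := ⨁ n : ℕ, GrPiece I n

end AssociatedGraded

section LocalAlgebra

variable (k A : Type*) [Field k] [CommRing A] [IsLocalRing A] [Algebra k A]

/-- The Hilbert function `HF_A(j) = dim_k (𝔪 ^ j / 𝔪 ^ (j + 1))` of a local `k`-algebra. -/
noncomputable def hilbertFn (j : ℕ) : ℕ :=
  Module.finrank k (GrPiece (IsLocalRing.maximalIdeal A) j)

/-- The socle `0 :_A 𝔪`. -/
def localSocle : Ideal A :=
  (IsLocalRing.maximalIdeal A).annihilator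

/-- The local ring `A` has socle degree `s`: `𝔪 ^ s ≠ 0` and `𝔪 ^ (s + 1) = 0`. -/
def HasSocleDegree (s : ℕ) : Prop :=
  IsLocalRing.maximalIdeal A ^ s ≠ ⊥ ∧ IsLocalRing.maximalIdeal A ^ (s + 1) = ⊥

/-- `A` is `s`-level of type `τ`: it has socle degree `s`, its socle is `𝔪 ^ s`, and the socle has
`k`-dimension `τ`. -/
def IsLevelOfType (s τ : ℕ) : Prop :=
  HasSocleDegree A s ∧ localSocle A = IsLocalRing.maximalIdeal A ^ s ∧
    Module.finrank k (localSocle A) = τ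

/-- `A` is a compressed level algebra of type `τ` and socle degree `3`: it is `3`-level of type `τ`
and its `h`-vector is `(1, m, min {τ m, binom (m + 1) 2}, τ)`, where `m` is the embedding
dimension. -/
def IsCompressedLevelThree (τ : ℕ) : Prop :=
  IsLevelOfType k A 3 τ ∧
    ∃ m : ℕ, hilbertFn k A 0 = 1 ∧ hilbertFn k A 1 = m ∧
      hilbertFn k A 2 = min (τ * m) ((m + 1).choose 2) ∧ hilbertFn k A 3 = τ

/-- `A` is graded: it is isomorphic, as a `k`-algebra, to its associated graded ring
`⨁ₙ 𝔪 ^ n / 𝔪 ^ (n + 1)`. -/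
def IsGradedLocalAlgebra : Prop :=
  Nonempty (A ≃ₐ[k] AssocGraded (IsLocalRing.maximalIdeal A))

end LocalAlgebra

/-! ### Linear maps into a Hom space. -/

section LinearAlgebra

variable {k E F G : Type*} [Field k] [AddCommGroup E] [Module k E] [AddCommGroup F] [Module k F]
  [AddCommGroup G] [Module k G]

/-! `A` is graded as soon as complements of `𝔪 ^ (n + 1)` in `𝔪 ^ n` can be chosen compatibly with
products (`nonempty_algEquiv_assocGraded`). Since `𝔪 ^ 4 = 0`, the only real condition is `V * V ≤
W`, with `V` a complement in degree 1 and `W` one in degree 2. The two values of the minimum are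
treated separately.

If `h₂ = binom (m + 1) 2`, then `V * V` spans `𝔪 ^ 2` modulo `𝔪 ^ 3` and is too small to meet `𝔪 ^
3`, so `W = V * V` works (`IsGradedComplement.square`).

If `h₂ = τ m`, levelness makes `𝔪 ^ 2 / 𝔪 ^ 3 → Hom (V, 𝔪 ^ 3)` injective, hence bijective by
dimension (`mulRestrict_surjective`). Fix any `W`, let `π` project `𝔪 ^ 2` onto `𝔪 ^ 3` along `W`,
and replace `v` by `v + D v`, where `D v ∈ 𝔪 ^ 2` satisfies `D v * w = -π (v * w) / 2`. By symmetry
the new products are `v * w - π (v * w) ∈ W` (`exists_isGradedComplement_mul_mem`). -/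

theorem LinearMap.exists_rightInverse_of_surjective₂ (f : E →ₗ[k] F →ₗ[k] G)
    (hf : Function.Surjective f) : ∃ s : (F →ₗ[k] G) →ₗ[k] E, ∀ g, f (s g) = g := by
  obtain ⟨s, hs⟩ := f.exists_rightInverse_of_surjective (LinearMap.range_eq_top.2 hf)
  exact ⟨s, LinearMap.congr_fun hs⟩

theorem LinearMap.surjective_of_finrank_le₂ [FiniteDimensional k E] [FiniteDimensional k F]
    [FiniteDimensional k G] (f : E →ₗ[k] F →ₗ[k] G)
    (hf : Module.finrank k (LinearMap.ker f) + Module.finrank k F * Module.finrank k G ≤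
      Module.finrank k E) : Function.Surjective f := by
  have h1 := f.finrank_range_add_finrank_ker
  have h2 := Submodule.finrank_le (LinearMap.range f)
  have h3 := Module.finrank_linearMap k k F G
  rw [← LinearMap.range_eq_top]
  apply Submodule.eq_top_of_finrank_eq
  omega

end LinearAlgebra

/-! ### Graded complements and the comparison with the associated graded ring. -/

section GradedComplements

variable {k A : Type*} [Field k] [CommRing A] [Algebra k A]

/-- The power `I ^ n` of an ideal of a `k`-algebra, as a `k`-subspace. -/
abbrev idealPow (k : Type*) {A : Type*} [Field k] [CommRing A] [Algebra k A] (I : Ideal A) (n : ℕ) :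
    Submodule k A :=
  (I ^ n).restrictScalars k

/-- A subspace `V` of `I ^ n` is a graded complement if `I ^ n = V ⊕ I ^ (n + 1)`. -/
structure IsGradedComplement (I : Ideal A) (n : ℕ) (V : Submodule k A) : Prop where
  disjoint : V ⊓ idealPow k I (n + 1) = ⊥
  sup_eq : V ⊔ idealPow k I (n + 1) = idealPow k I n

namespace IsGradedComplement

variable {I : Ideal A} {n : ℕ} {V : Submodule k A}

theorem le (h : IsGradedComplement I n V) : V ≤ idealPow k I n :=
  h.sup_eq ▸ le_sup_left

theorem eq_zero (h : IsGradedComplement I n V) {x : A} (hx : x ∈ V) (hx' : x ∈ I ^ (n + 1)) :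
    x = 0 := by
  have : x ∈ V ⊓ idealPow k I (n + 1) := ⟨hx, hx'⟩
  rwa [h.disjoint, Submodule.mem_bot] at this

/-- A graded complement maps isomorphically onto the graded piece. -/
noncomputable def equiv (h : IsGradedComplement I n V) : V ≃ₗ[k] GrPiece I n :=
  LinearEquiv.ofBijective
    { toFun := fun v : V => GrPiece.mk I n ⟨v, h.le v.2⟩
      map_add' := fun v w : V => map_add (GrPiece.mk I n) ⟨v, h.le v.2⟩ ⟨w, h.le w.2⟩
      map_smul' := fun (c : k) (v : V) => (GrPiece.smul_mk k I n c ⟨v, h.le v.2⟩).symm }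
    (by
      constructor
      · rw [← LinearMap.ker_eq_bot, LinearMap.ker_eq_bot']
        intro v hv
        exact Subtype.ext (h.eq_zero v.2 ((GrPiece.mk_eq_zero I n _).1 hv))
      · intro y
        obtain ⟨x, rfl⟩ := GrPiece.mk_surjective I n y
        have hx : (x : A) ∈ V ⊔ idealPow k I (n + 1) := by rw [h.sup_eq]; exact x.2
        obtain ⟨v, hv, z, hz, hvz⟩ := Submodule.mem_sup.1 hx
        refine ⟨⟨v, hv⟩, ?_⟩
        rw [← sub_eq_zero]
        change GrPiece.mk I n ⟨v, h.le hv⟩ - GrPiece.mk I n x = 0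
        rw [← map_sub, GrPiece.mk_eq_zero]
        change v - (x : A) ∈ _
        rw [← hvz, sub_add_cancel_left]
        exact neg_mem hz)

/-- The representative in `V` of a class in `I ^ n / I ^ (n + 1)`. -/
noncomputable def lift (h : IsGradedComplement I n V) : GrPiece I n →ₗ[k] A :=
  V.subtype ∘ₗ h.equiv.symm.toLinearMap

theorem lift_mem (h : IsGradedComplement I n V) (x : GrPiece I n) : h.lift x ∈ V :=
  (h.equiv.symm x).2

theorem mk_lift (h : IsGradedComplement I n V) (x : GrPiece I n) :
    GrPiece.mk I n ⟨h.lift x, h.le (h.lift_mem x)⟩ = x :=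
  h.equiv.apply_symm_apply x

theorem lift_mk (h : IsGradedComplement I n V) {v : A} (hv : v ∈ V) :
    h.lift (GrPiece.mk I n ⟨v, h.le hv⟩) = v :=
  congrArg Subtype.val (h.equiv.symm_apply_apply ⟨v, hv⟩)

theorem finrank_eq (h : IsGradedComplement I n V) :
    Module.finrank k V = Module.finrank k (GrPiece I n) :=
  h.equiv.finrank_eq

end IsGradedComplement

theorem exists_isGradedComplement (I : Ideal A) (n : ℕ) :
    ∃ V : Submodule k A, IsGradedComplement I n V := by
  obtain ⟨C, hC⟩ := exists_isCompl (idealPow k I (n + 1))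
  have hle : idealPow k I (n + 1) ≤ idealPow k I n := Ideal.pow_le_pow_right n.le_succ
  refine ⟨idealPow k I n ⊓ C, ?_, ?_⟩
  · rw [inf_assoc, inf_comm C, hC.inf_eq_bot, inf_bot_eq]
  · rw [sup_comm, ← inf_comm C, ← sup_inf_assoc_of_le C hle, hC.sup_eq_top, top_inf_eq]

-- The lifts assemble into a map from the graded ring to `A`. It is multiplicative because a product
-- of representatives lies in `W (i + j)` and so is itself the representative of its class.
open Classical in
theorem nonempty_algEquiv_assocGraded (I : Ideal A) {N : ℕ} (hN : I ^ N = ⊥)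
    (W : ℕ → Submodule k A) (hW : ∀ n, IsGradedComplement I n (W n))
    (hone : (1 : A) ∈ W 0) (hmul : ∀ i j, ∀ x ∈ W i, ∀ y ∈ W j, x * y ∈ W (i + j)) :
    Nonempty (A ≃ₐ[k] AssocGraded I) := by
  let f : AssocGraded I →ₐ[k] A := DirectSum.toAlgebra k (GrPiece I) (fun n => (hW n).lift)
    ((hW 0).lift_mk hone)
    (by
      intro i j x y
      have h := (hW (i + j)).lift_mk
        (hmul i j _ ((hW i).lift_mem x) _ ((hW j).lift_mem y))
      rw [← h]
      congr 1
      conv_lhs => rw [← (hW i).mk_lift x, ← (hW j).mk_lift y]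
      rfl)
  have hf : ∀ n x, f (DirectSum.of (GrPiece I) n x) = (hW n).lift x := fun n x =>
    DirectSum.toAddMonoid_of (fun n => (hW n).lift.toAddMonoidHom) n x
  have hsurj : Function.Surjective f := by
    -- Descending induction on the power of `I`, starting where it vanishes.
    have key : ∀ d n, N ≤ n + d → idealPow k I n ≤ LinearMap.range f.toLinearMap := by
      intro d
      induction d with
      | zero =>
        intro n hn x hx
        have : x ∈ I ^ N := Ideal.pow_le_pow_right (by simpa using hn) hx
        rw [hN, Ideal.mem_bot] at this
        rw [this]
        exact zero_mem _
      | succ d ih =>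
        intro n hn
        rw [← (hW n).sup_eq]
        refine sup_le (fun v hv => ?_) (ih (n + 1) (by omega))
        exact ⟨_, (hf n _).trans ((hW n).lift_mk hv)⟩
    intro a
    exact key N 0 (by omega) (show a ∈ I ^ 0 by simp)
  have hinj : Function.Injective f := by
    rw [injective_iff_map_eq_zero]
    intro x hx
    have hsum : ∑ i ∈ DFinsupp.support x, (hW i).lift (x i) = 0 := by
      rw [← hx]
      conv_rhs => rw [← DirectSum.sum_support_of x, map_sum]
      exact Finset.sum_congr rfl fun i _ => (hf i _).symm
    ext n
    induction n using Nat.strong_induction_on with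
    | _ n ih =>
      by_contra hne
      have hmem : n ∈ DFinsupp.support x := DFinsupp.mem_support_iff.2 hne
      rw [← Finset.add_sum_erase _ _ hmem, add_eq_zero_iff_eq_neg] at hsum
      -- Lower components vanish by induction and higher ones lie in `I ^ (n + 1)`, so the lift of
      -- `x n` lies in `W n ⊓ I ^ (n + 1)`.
      have hrest : ∑ i ∈ (DFinsupp.support x).erase n, (hW i).lift (x i) ∈ I ^ (n + 1) := by
        refine sum_mem fun i hi => ?_
        rcases lt_or_ge i n with h | h
        · have : x i = 0 := ih i h
          rw [this, map_zero]
          exact zero_mem _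
        · have : n + 1 ≤ i := by
            have := Finset.ne_of_mem_erase hi
            omega
          exact Ideal.pow_le_pow_right this ((hW i).le ((hW i).lift_mem _))
      have h0 := (hW n).eq_zero ((hW n).lift_mem (x n)) (hsum ▸ neg_mem hrest)
      apply hne
      rw [← (hW n).mk_lift (x n)]
      refine (GrPiece.mk_eq_zero I n _).2 ?_
      change (hW n).lift (x n) ∈ _
      rw [h0]
      exact zero_mem _
  exact ⟨(AlgEquiv.ofBijective f ⟨hinj, hsurj⟩).symm⟩

theorem isGradedComplement_zero (I : Ideal A) (hI : I ≠ ⊤)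
    (hsurj : ∀ a : A, ∃ c : k, a - algebraMap k A c ∈ I) :
    IsGradedComplement I 0 (1 : Submodule k A) where
  disjoint := by
    rw [eq_bot_iff]
    rintro x ⟨hx, hx'⟩
    obtain ⟨c, rfl⟩ := Submodule.mem_one.1 hx
    rw [Submodule.mem_bot]
    by_contra hc
    have hc0 : c ≠ 0 := by rintro rfl; exact hc (map_zero _)
    refine hI (Ideal.eq_top_of_isUnit_mem I ?_ ((isUnit_iff_ne_zero.2 hc0).map (algebraMap k A)))
    simpa using hx'
  sup_eq := by
    ext a
    simp only [Submodule.mem_sup, pow_zero, Submodule.restrictScalars_mem, zero_add, pow_one,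
      Submodule.mem_one, Ideal.one_eq_top, Submodule.mem_top, iff_true]
    obtain ⟨c, hc⟩ := hsurj a
    exact ⟨_, ⟨c, rfl⟩, _, hc, by ring⟩

/-! ### Finiteness, dimension counts, and the case `h₂ = binom (m + 1) 2`. -/

/-- Coefficients in `A` are scalars modulo `I`, so `A`-generators of `I ^ n` span it over `k` up to
`I ^ (n + 1)`; descend from `I ^ N = 0`. -/
theorem finiteDimensional_idealPow [IsNoetherianRing A] (I : Ideal A) {N : ℕ} (hN : I ^ N = ⊥)
    (hsurj : ∀ a : A, ∃ c : k, a - algebraMap k A c ∈ I) (n : ℕ) :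
    FiniteDimensional k (idealPow k I n) := by
  have step : ∀ n, ∃ S : Finset A, idealPow k I n =
      Submodule.span k (S : Set A) ⊔ idealPow k I (n + 1) := by
    intro n
    obtain ⟨S, hS⟩ := (IsNoetherian.noetherian (I ^ n) : (I ^ n).FG)
    have hSle : (S : Set A) ⊆ (I ^ n : Ideal A) := hS ▸ Submodule.subset_span
    refine ⟨S, le_antisymm (fun x hx => ?_)
      (sup_le (Submodule.span_le.2 hSle) (Ideal.pow_le_pow_right n.le_succ))⟩
    replace hx : x ∈ Submodule.span A (S : Set A) := hS ▸ hx
    induction hx using Submodule.span_induction with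
    | mem x h => exact Submodule.mem_sup_left (Submodule.subset_span h)
    | zero => exact zero_mem _
    | add x y _ _ hx hy => exact add_mem hx hy
    | smul a x h hx =>
      obtain ⟨c, hc⟩ := hsurj a
      have : a • x = c • x + (a - algebraMap k A c) * x := by
        rw [Algebra.smul_def c, smul_eq_mul]; ring
      rw [this]
      refine add_mem (Submodule.smul_mem _ _ hx) (Submodule.mem_sup_right ?_)
      change _ ∈ I ^ (n + 1)
      rw [pow_succ']
      exact Ideal.mul_mem_mul hc (hS ▸ h)
  have key : ∀ d n, N ≤ n + d → (idealPow k I n).FG := by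
    intro d
    induction d with
    | zero =>
      intro n hn
      have : idealPow k I n = ⊥ := by
        rw [eq_bot_iff]
        intro x hx
        have hx : x ∈ I ^ N := Ideal.pow_le_pow_right (by simpa using hn) hx
        rwa [hN] at hx
      rw [this]
      exact Submodule.fg_bot
    | succ d ih =>
      intro n hn
      obtain ⟨S, hS⟩ := step n
      rw [hS]
      exact (Submodule.fg_span S.finite_toSet).sup (ih (n + 1) (by omega))
  exact Module.Finite.iff_fg.2 (key N n (by omega))

/-- Products of basis vectors span, and by commutativity they are indexed by unordered pairs. -/
theorem finrank_mul_self_le (V : Submodule k A) [FiniteDimensional k V] :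
    Module.finrank k ↥(V * V) ≤ (Module.finrank k V + 1).choose 2 := by
  let b := Module.finBasis k V
  let g : Sym2 (Fin (Module.finrank k V)) → A :=
    Sym2.lift ⟨fun i j => (b i : A) * b j, fun i j => mul_comm _ _⟩
  have hV : V = Submodule.span k (Set.range fun i => (b i : A)) := by
    have := congrArg (Submodule.map V.subtype) b.span_eq
    rw [Submodule.map_span, Submodule.map_top, Submodule.range_subtype, ← Set.range_comp] at this
    exact this.symm
  have hVV : V * V = Submodule.span k (Set.range g) := by
    conv_lhs => rw [hV]
    rw [Submodule.span_mul_span]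
    congr 1
    ext x
    simp only [Set.mem_mul, Set.mem_range]
    constructor
    · rintro ⟨_, ⟨i, rfl⟩, _, ⟨j, rfl⟩, rfl⟩
      exact ⟨s(i, j), rfl⟩
    · rintro ⟨z, rfl⟩
      induction z with
      | _ i j => exact ⟨_, ⟨i, rfl⟩, _, ⟨j, rfl⟩, rfl⟩
  rw [hVV]
  refine (finrank_range_le_card g).trans ?_
  rw [Sym2.card, Fintype.card_fin]

theorem IsGradedComplement.finrank_add {I : Ideal A} {n : ℕ} {V : Submodule k A}
    (h : IsGradedComplement I n V) [FiniteDimensional k (idealPow k I n)] :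
    Module.finrank k (GrPiece I n) + Module.finrank k (idealPow k I (n + 1)) =
      Module.finrank k (idealPow k I n) := by
  have := Submodule.finiteDimensional_of_le h.le
  have : FiniteDimensional k (idealPow k I (n + 1)) := Submodule.finiteDimensional_of_le
    (show idealPow k I (n + 1) ≤ idealPow k I n from Ideal.pow_le_pow_right n.le_succ)
  have e := Submodule.finrank_sup_add_finrank_inf_eq V (idealPow k I (n + 1))
  rw [h.sup_eq, h.disjoint, finrank_bot, add_zero, h.finrank_eq] at e
  exact e.symm

theorem IsGradedComplement.square_sup_eq {I : Ideal A} {V : Submodule k A}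
    (h : IsGradedComplement I 1 V) : V * V ⊔ idealPow k I 3 = idealPow k I 2 := by
  have hV : ∀ x ∈ V, x ∈ I := fun x hx => by simpa using h.le hx
  refine le_antisymm (sup_le ?_ (Ideal.pow_le_pow_right (by norm_num))) ?_
  · rw [Submodule.mul_le]
    intro x hx y hy
    change x * y ∈ I ^ 2
    rw [pow_two]
    exact Ideal.mul_mem_mul (hV x hx) (hV y hy)
  · intro z hz
    have hz : z ∈ I * I := by rw [← pow_two]; exact hz
    refine Submodule.mul_induction_on hz (fun x hx y hy => ?_) (fun x y hx hy => add_mem hx hy)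
    have hI : ∀ x ∈ I, ∃ v ∈ V, ∃ u ∈ I ^ 2, v + u = x := fun x hx => by
      refine Submodule.mem_sup.1 (?_ : x ∈ V ⊔ idealPow k I (1 + 1))
      rw [h.sup_eq]
      change x ∈ I ^ 1
      rwa [pow_one]
    obtain ⟨v, hv, u, hu, rfl⟩ := hI x hx
    obtain ⟨w, hw, t, ht, rfl⟩ := hI y hy
    have : (v + u) * (w + t) = v * w + (u * (w + t) + v * t) := by ring
    rw [this]
    refine add_mem (Submodule.mem_sup_left (Submodule.mul_mem_mul hv hw))
      (Submodule.mem_sup_right (?_ : _ ∈ I ^ 3))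
    refine add_mem ?_ ?_
    · rw [pow_succ]; exact Ideal.mul_mem_mul hu hy
    · rw [pow_succ']; exact Ideal.mul_mem_mul (hV v hv) ht

/-- If the square of a complement of `I ^ 2` has small enough dimension, it is a complement of
`I ^ 3` in `I ^ 2`. -/
theorem IsGradedComplement.square {I : Ideal A} {V : Submodule k A}
    (h : IsGradedComplement I 1 V) [FiniteDimensional k (idealPow k I 1)]
    (hdim : Module.finrank k (GrPiece I 2) = (Module.finrank k (GrPiece I 1) + 1).choose 2) :
    IsGradedComplement I 2 (V * V) := by
  have f1 := Submodule.finiteDimensional_of_le h.le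
  have f2 : FiniteDimensional k (idealPow k I 2) := Submodule.finiteDimensional_of_le
    (show idealPow k I 2 ≤ idealPow k I 1 from Ideal.pow_le_pow_right (by norm_num))
  have f3 : FiniteDimensional k (idealPow k I 3) := Submodule.finiteDimensional_of_le
    (show idealPow k I 3 ≤ idealPow k I 1 from Ideal.pow_le_pow_right (by norm_num))
  have f4 : FiniteDimensional k ↥(V * V) := Submodule.finiteDimensional_of_le
    (show V * V ≤ idealPow k I 2 from h.square_sup_eq ▸ le_sup_left)
  refine ⟨?_, h.square_sup_eq⟩
  obtain ⟨U, hU⟩ := exists_isGradedComplement (k := k) I 2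
  have e1 := hU.finrank_add
  have e2 := Submodule.finrank_sup_add_finrank_inf_eq (V * V) (idealPow k I 3)
  rw [h.square_sup_eq] at e2
  -- This bounds `dim (V * V)` by `dim (I ^ 2 / I ^ 3)`, leaving no room for an intersection with `I
  -- ^ 3`.
  have e3 := finrank_mul_self_le V
  rw [h.finrank_eq, ← hdim] at e3
  apply Submodule.finrank_eq_zero.1
  change Module.finrank k ↥((V * V) ⊓ idealPow k I 3) = 0
  simp only [Nat.reduceAdd] at e1
  omega

/-! ### The case `h₂ = τ m`: correcting the degree 1 complement. -/

/-- Multiplication `I ^ 2 → Hom (V, I ^ 3)` for a subspace `V` of `I`. -/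
def mulRestrict (I : Ideal A) (V : Submodule k A) (hV : ∀ x ∈ V, x ∈ I) :
    idealPow k I 2 →ₗ[k] V →ₗ[k] idealPow k I 3 :=
  LinearMap.mk₂ k
    (fun u v => ⟨(u : A) * v, show (u : A) * v ∈ I ^ 3 by
      rw [pow_succ]; exact Ideal.mul_mem_mul u.2 (hV v v.2)⟩)
    (fun u u' v => Subtype.ext (add_mul (u : A) u' v))
    (fun c u v => Subtype.ext (smul_mul_assoc c (u : A) v))
    (fun u v v' => Subtype.ext (mul_add (u : A) v v'))
    (fun c u v => Subtype.ext (mul_smul_comm c (u : A) v))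

theorem mulRestrict_apply (I : Ideal A) (V : Submodule k A) (hV : ∀ x ∈ V, x ∈ I)
    (u : idealPow k I 2) (v : V) : (mulRestrict I V hV u v : A) = u * v := rfl

/-- An element of `I ^ 2` killing `V` also kills `I ^ 2`, as `I ^ 4 = 0`, hence kills `I` and lies
in the socle `I ^ 3`. Rank-nullity then forces surjectivity. -/
theorem mulRestrict_surjective {I : Ideal A} {V : Submodule k A} (h : IsGradedComplement I 1 V)
    (hV : ∀ x ∈ V, x ∈ I) [FiniteDimensional k (idealPow k I 1)] (h4 : I ^ 4 = ⊥)
    (hsoc : I.annihilator = I ^ 3)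
    (hdim : Module.finrank k (GrPiece I 2) =
      Module.finrank k (idealPow k I 3) * Module.finrank k (GrPiece I 1)) :
    Function.Surjective (mulRestrict I V hV) := by
  have f1 := Submodule.finiteDimensional_of_le h.le
  have f2 : FiniteDimensional k (idealPow k I 2) := Submodule.finiteDimensional_of_le
    (show idealPow k I 2 ≤ idealPow k I 1 from Ideal.pow_le_pow_right (by norm_num))
  have f3 : FiniteDimensional k (idealPow k I 3) := Submodule.finiteDimensional_of_le
    (show idealPow k I 3 ≤ idealPow k I 1 from Ideal.pow_le_pow_right (by norm_num))
  have hker : Module.finrank k (LinearMap.ker (mulRestrict I V hV)) ≤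
      Module.finrank k (idealPow k I 3) := by
    rw [← LinearMap.finrank_range_of_inj (f := (idealPow k I 2).subtype.domRestrict
      (LinearMap.ker (mulRestrict I V hV))) (fun x y hxy => Subtype.ext (Subtype.ext hxy))]
    apply Submodule.finrank_mono
    rintro _ ⟨⟨u, hu⟩, rfl⟩
    change (u : A) ∈ I ^ 3
    rw [← hsoc, Submodule.mem_annihilator]
    intro x hx
    have hx : x ∈ V ⊔ idealPow k I (1 + 1) := by
      rw [h.sup_eq]
      change x ∈ I ^ 1
      rwa [pow_one]
    obtain ⟨v, hv, t, ht, rfl⟩ := Submodule.mem_sup.1 hx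
    have h1 : (u : A) * v = 0 := by
      rw [← mulRestrict_apply I V hV u ⟨v, hv⟩, LinearMap.mem_ker.1 hu]
      rfl
    have h2 : (u : A) * t = 0 := by
      have : (u : A) * t ∈ I ^ 4 := by
        rw [show 4 = 2 + 2 from rfl, pow_add]
        exact Ideal.mul_mem_mul u.2 ht
      rwa [h4] at this
    rw [smul_eq_mul, mul_add, h1, h2, add_zero]
  obtain ⟨U, hU⟩ := exists_isGradedComplement (k := k) I 2
  have e1 := hU.finrank_add
  apply LinearMap.surjective_of_finrank_le₂
  rw [h.finrank_eq]
  simp only [Nat.reduceAdd] at e1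
  rw [← e1, hdim, mul_comm]
  omega

/-- When multiplication by `I ^ 2` realizes all linear maps from a complement of `I ^ 2` to
`I ^ 3`, complements of `I ^ 2` and `I ^ 3` can be chosen compatibly with products. -/
theorem exists_isGradedComplement_mul_mem {I : Ideal A} {V : Submodule k A}
    (h2 : (2 : k) ≠ 0) (h : IsGradedComplement I 1 V) (hV : ∀ x ∈ V, x ∈ I) (h4 : I ^ 4 = ⊥)
    (hsurj : Function.Surjective (mulRestrict I V hV)) :
    ∃ V' W : Submodule k A, IsGradedComplement I 1 V' ∧ IsGradedComplement I 2 W ∧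
      ∀ x ∈ V', ∀ y ∈ V', x * y ∈ W := by
  obtain ⟨W, hW⟩ := exists_isGradedComplement (k := k) I 2
  -- Enlarging `W` to a complement of `I ^ 3` in all of `A` gives a projection defined on `A` that
  -- kills `W`.
  obtain ⟨C, hWC, hC⟩ : ∃ C, W ≤ C ∧ IsCompl (idealPow k I 3) C := by
    obtain ⟨C, hC, hWC⟩ := (disjoint_iff.2 hW.disjoint).exists_isCompl
    exact ⟨C, hC, hWC.symm⟩
  let π : A →ₗ[k] idealPow k I 3 := Submodule.projectionOnto _ C hC
  have hπ : ∀ x ∈ I ^ 2, x - π x ∈ W := by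
    intro x hx
    have hx : x ∈ W ⊔ idealPow k I (2 + 1) := by rw [hW.sup_eq]; exact hx
    obtain ⟨w, hw, z, hz, rfl⟩ := Submodule.mem_sup.1 hx
    have e1 : π w = 0 := (Submodule.projectionOnto_apply_eq_zero_iff hC).2 (hWC hw)
    have e2 : π z = ⟨z, hz⟩ := Submodule.projectionOnto_apply_left hC ⟨z, hz⟩
    rw [map_add, e1, e2]
    simpa using hw
  obtain ⟨s, hs⟩ := LinearMap.exists_rightInverse_of_surjective₂ _ hsurj
  -- The factor `-1/2` appears because both `D v * w` and `v * D w` contribute the same correction.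
  let B : V →ₗ[k] V →ₗ[k] idealPow k I 3 :=
    (-(2 : k)⁻¹) • ((LinearMap.mul k A).compl₁₂ V.subtype V.subtype).compr₂ π
  let D : V →ₗ[k] A := (idealPow k I 2).subtype ∘ₗ s ∘ₗ B
  have hD : ∀ v, D v ∈ I ^ 2 := fun v => (s (B v)).2
  have hDmul : ∀ v w : V, D v * w = -(2 : k)⁻¹ • (π ((v : A) * w) : A) := fun v w =>
    congrArg Subtype.val (LinearMap.congr_fun (hs (B v)) w)
  refine ⟨LinearMap.range (V.subtype + D), W, ⟨?_, ?_⟩, hW, ?_⟩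
  · rw [eq_bot_iff]
    rintro _ ⟨⟨v, rfl⟩, hx⟩
    have hv : (v : A) ∈ I ^ (1 + 1) := by
      have := sub_mem (show (v : A) + D v ∈ I ^ (1 + 1) from hx) (hD v)
      rwa [add_sub_cancel_right] at this
    have : v = 0 := Subtype.ext (h.eq_zero v.2 hv)
    rw [this, map_zero]
    exact zero_mem _
  · apply le_antisymm
    · refine sup_le ?_ (Ideal.pow_le_pow_right (by norm_num))
      rintro _ ⟨v, rfl⟩
      exact add_mem (h.le v.2) (Ideal.pow_le_pow_right (show 1 ≤ 2 by norm_num) (hD v))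
    · rw [← h.sup_eq]
      refine sup_le (fun v hv => ?_) le_sup_right
      have : v = (V.subtype + D) ⟨v, hv⟩ - D ⟨v, hv⟩ := (add_sub_cancel_right _ _).symm
      rw [this]
      exact sub_mem (Submodule.mem_sup_left ⟨_, rfl⟩) (Submodule.mem_sup_right (hD _))
  · rintro _ ⟨v, rfl⟩ _ ⟨w, rfl⟩
    have hDD : D v * D w = 0 := by
      have : D v * D w ∈ I ^ 4 := by
        rw [show 4 = 2 + 2 from rfl, pow_add]
        exact Ideal.mul_mem_mul (hD v) (hD w)
      rwa [h4] at this
    have hvw : (v : A) * w ∈ I ^ 2 := by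
      rw [pow_two]
      exact Ideal.mul_mem_mul (hV v v.2) (hV w w.2)
    have : (V.subtype + D) v * (V.subtype + D) w = (v : A) * w - π ((v : A) * w) := by
      have e : (V.subtype + D) v * (V.subtype + D) w
          = (v : A) * w + (D v * w + D w * v) + D v * D w := by
        change ((v : A) + D v) * ((w : A) + D w) = _
        ring
      have e' : -(2 : k)⁻¹ + -(2 : k)⁻¹ = -1 := by field_simp; norm_num
      rw [e, hDD, hDmul, hDmul, mul_comm (w : A) v, ← add_smul, e', neg_one_smul]
      ring
    rw [this]
    exact hπ _ hvw

/-! ### Assembling the grading when `I ^ 4 = 0`. -/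

theorem nonempty_algEquiv_assocGraded_of_pow_four_eq_bot {I : Ideal A} (hI : I ≠ ⊤)
    (hsurj : ∀ a : A, ∃ c : k, a - algebraMap k A c ∈ I) (h4 : I ^ 4 = ⊥)
    {V W : Submodule k A} (hV : IsGradedComplement I 1 V) (hW : IsGradedComplement I 2 W)
    (hmul : ∀ x ∈ V, ∀ y ∈ V, x * y ∈ W) : Nonempty (A ≃ₐ[k] AssocGraded I) := by
  have hbot : ∀ n, 4 ≤ n → I ^ n = ⊥ := fun n hn =>
    eq_bot_iff.2 (h4 ▸ Ideal.pow_le_pow_right hn)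
  let U : ℕ → Submodule k A := fun
    | 0 => 1
    | 1 => V
    | 2 => W
    -- Taking the full power is allowed because the next one is zero, and it makes products of total
    -- degree at least 3 automatic.
    | n + 3 => idealPow k I (n + 3)
  have hU : ∀ n, IsGradedComplement I n (U n) := fun
    | 0 => isGradedComplement_zero I hI hsurj
    | 1 => hV
    | 2 => hW
    | n + 3 => by
      have : idealPow k I (n + 3 + 1) = ⊥ := by
        rw [idealPow, hbot _ (by omega), Submodule.restrictScalars_bot]
      exact ⟨by rw [this, inf_bot_eq], by rw [this, sup_bot_eq]⟩
  refine nonempty_algEquiv_assocGraded I h4 U hU (Submodule.one_le.1 le_rfl) fun i j x hx y hy => ?_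
  have hpow : x * y ∈ I ^ (i + j) := by
    rw [pow_add]
    exact Ideal.mul_mem_mul ((hU i).le hx) ((hU j).le hy)
  rcases Nat.eq_zero_or_pos i with rfl | hi
  · obtain ⟨c, rfl⟩ := Submodule.mem_one.1 hx
    rw [← Algebra.smul_def, zero_add]
    exact Submodule.smul_mem _ _ hy
  rcases Nat.eq_zero_or_pos j with rfl | hj
  · obtain ⟨c, rfl⟩ := Submodule.mem_one.1 hy
    rw [mul_comm, ← Algebra.smul_def]
    exact Submodule.smul_mem _ _ hx
  obtain ⟨rfl, rfl⟩ | h3 : (i = 1 ∧ j = 1) ∨ 3 ≤ i + j := by omega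
  · exact hmul x hx y hy
  · obtain ⟨n, hn⟩ := Nat.exists_eq_add_of_le' h3
    rw [hn] at hpow ⊢
    exact hpow

end GradedComplements

theorem theorem3p4 {k A : Type*} [Field k] [IsAlgClosed k] [CharZero k]
    [CommRing A] [IsLocalRing A] [IsArtinianRing A] [Algebra k A]
    (hk : Function.Bijective (algebraMap k (IsLocalRing.ResidueField A)))
    (τ : ℕ) (hA : IsCompressedLevelThree k A τ) :
    IsGradedLocalAlgebra k A := by
  obtain ⟨⟨⟨-, h4⟩, hsoc, hτ⟩, m, -, h1, h2, -⟩ := hA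
  simp only [Nat.reduceAdd] at h4
  have hI : IsLocalRing.maximalIdeal A ≠ ⊤ := Ideal.IsPrime.ne_top'
  have hsurj : ∀ a : A, ∃ c : k, a - algebraMap k A c ∈ IsLocalRing.maximalIdeal A := by
    intro a
    obtain ⟨c, hc⟩ := hk.2 (IsLocalRing.residue A a)
    refine ⟨c, ?_⟩
    rw [← IsLocalRing.residue_eq_zero_iff, map_sub, ← hc, sub_eq_zero]
    rfl
  have hfin := finiteDimensional_idealPow _ h4 hsurj 1
  obtain ⟨V, hV⟩ := exists_isGradedComplement (k := k) (IsLocalRing.maximalIdeal A) 1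
  have hVI : ∀ x ∈ V, x ∈ IsLocalRing.maximalIdeal A := fun x hx => by simpa using hV.le hx
  have hτ3 : Module.finrank k (idealPow k (IsLocalRing.maximalIdeal A) 3) = τ := by
    rw [← hτ, hsoc]
    rfl
  -- In the first case the dimension of `𝔪 ^ 2 / 𝔪 ^ 3` is that of `Hom (V, 𝔪 ^ 3)`; in the second
  -- it is that of the symmetric square of `V`.
  rcases min_choice (τ * m) ((m + 1).choose 2) with h | h
  · have hdim : Module.finrank k (GrPiece (IsLocalRing.maximalIdeal A) 2) =
        Module.finrank k (idealPow k (IsLocalRing.maximalIdeal A) 3) *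
          Module.finrank k (GrPiece (IsLocalRing.maximalIdeal A) 1) := by
      rw [hτ3]
      exact h2.trans (h.trans (congrArg _ h1.symm))
    obtain ⟨V', W, hV', hW, hmul⟩ := exists_isGradedComplement_mul_mem two_ne_zero hV hVI h4
      (mulRestrict_surjective hV hVI h4 hsoc hdim)
    exact nonempty_algEquiv_assocGraded_of_pow_four_eq_bot hI hsurj h4 hV' hW hmul
  · have hdim : Module.finrank k (GrPiece (IsLocalRing.maximalIdeal A) 2) =
        (Module.finrank k (GrPiece (IsLocalRing.maximalIdeal A) 1) + 1).choose 2 :=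
      h2.trans (h.trans (by rw [← h1]; rfl))
    exact nonempty_algEquiv_assocGraded_of_pow_four_eq_bot hI hsurj h4 hV (hV.square hdim)
      fun x hx y hy => Submodule.mul_mem_mul hx hy
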